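/- Let $D=(V,A)$, $A\subseteq V\times V$, be a finite minimal strong digraph, i.e. a finite strongly connected digraph such that deleting any single arc yields a digraph that is not strongly connected. Suppose that $D$ contains a directed cycle $C_q$ of length $q$ (with $q$ distinct vertices, not necessarily induced). Call a vertex of $D$ linear if its indegree and its outdegree are both equal to $1$, and let $\alpha$ be the number of linear vertices of $D$. Then $$\alpha \ge \left\lfloor \frac{q+1}{2}\right\rfloor .$$ -/

import Mathlib

namespace Digraph

/-- Every vertex can be reached from every vertex by a directed path (possibly of length zero). -/
def IsStrong {V : Type*} (D : Digraph V) : Prop :=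
  ∀ u v : V, Relation.ReflTransGen D.Adj u v

/-- The digraph obtained from `D` by deleting the arc `uv`, keeping all vertices. -/
def deleteArc {V : Type*} (D : Digraph V) (u v : V) : Digraph V where
  Adj a b := D.Adj a b ∧ ¬ (a = u ∧ b = v)

/-- A minimal strong digraph: a strong digraph in which the deletion of any arc yields a digraph
that is not strong. (In particular, such a digraph has no loops.) -/
def IsMinimalStrong {V : Type*} (D : Digraph V) : Prop :=
  D.IsStrong ∧ ∀ u v : V, D.Adj u v → ¬ (D.deleteArc u v).IsStrong

/-- The number of arcs leaving `v`. -/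
noncomputable def outdegree {V : Type*} (D : Digraph V) (v : V) : ℕ :=
  {w : V | D.Adj v w}.ncard

/-- The number of arcs entering `v`. -/
noncomputable def indegree {V : Type*} (D : Digraph V) (v : V) : ℕ :=
  {w : V | D.Adj w v}.ncard

/-- A linear vertex: indegree and outdegree are both `1`. -/
def IsLinearVertex {V : Type*} (D : Digraph V) (v : V) : Prop :=
  D.indegree v = 1 ∧ D.outdegree v = 1

/-- `c` lists, in cyclic order, the `q` distinct vertices of a directed cycle of length `q`
contained in `D` (not necessarily induced). -/
def IsDirectedCycle {V : Type*} (D : Digraph V) (q : ℕ) (c : ZMod q → V) : Prop :=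
  0 < q ∧ Function.Injective c ∧ ∀ i : ZMod q, D.Adj (c i) (c (i + 1))

end Digraph

/-! When an arc `ab` of a minimal strong digraph `D` is deleted, the vertices still reachable from
`a` form a proper subset on which `D` is strong. Two such subsets, for distinct arcs whose tails
lie in both, cover all vertices.

If `T` is a maximal proper subset on which `D` is strong and an arc `sy` leaves `T`, then `y` is
linear: a second arc into `y`, or a second arc out of `y`, would yield a proper subset of the above
kind, for the reverse of `D` or for `D`, strictly containing `T`. Hence every nonempty proper subset
on which `D` is strong misses a linear vertex.

Let `S` be the vertex set of the cycle. Every `s ∈ S` with an arc leaving `S` provides a linear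
vertex not reachable from `s` without that arc; by the covering property these linear vertices are
distinct, and they lie outside `S`. Reversing all arcs, the same holds for the vertices of `S`
entered from outside `S`. As the cycle has no chords, the remaining vertices of `S` are linear.
Writing `L` for the set of linear vertices, this gives `q ≤ |L ∩ S| + 2 |L \ S|`.
-/

namespace MinimalStrongDigraph

open Relation

variable {V : Type*} {D : Digraph V} {S T : Set V} {a b s v y : V}

lemma rel_of_reflTransGen (hD : D.IsMinimalStrong) {r : V → V → Prop}
    (hr : ∀ u v, r u v → D.Adj u v) (hadj : D.Adj a b) (hab : ReflTransGen r a b) : r a b := by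
  by_contra hnot
  refine hD.2 a b hadj fun u v ↦ reflTransGen_closed (fun x y hxy ↦ ?_) _ _ (hD.1 u v)
  by_cases h : x = a ∧ y = b
  · obtain ⟨rfl, rfl⟩ := h
    refine ReflTransGen.mono (fun u v huv ↦ ⟨hr u v huv, ?_⟩) _ _ hab
    rintro ⟨rfl, rfl⟩
    exact hnot huv
  · exact .single ⟨hxy, h⟩

lemma isLinearVertex_iff :
    D.IsLinearVertex v ↔ (∃! w, D.Adj w v) ∧ ∃! w, D.Adj v w := by
  simp only [Digraph.IsLinearVertex, Digraph.indegree, Digraph.outdegree, Set.ncard_eq_one,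
    Set.singleton_iff_unique_mem, Set.mem_ofPred_eq]

/-- The digraph obtained from `D` by reversing all arcs, used to dualize statements about arcs
leaving a set into statements about arcs entering it. -/
def reverse (D : Digraph V) : Digraph V where
  Adj a b := D.Adj b a

lemma isMinimalStrong_reverse (hD : D.IsMinimalStrong) : (reverse D).IsMinimalStrong := by
  refine ⟨fun u v ↦ (hD.1 v u).swap, fun u v huv h ↦ hD.2 v u huv fun a b ↦ ?_⟩
  exact ReflTransGen.mono (fun x y hxy ↦ ⟨hxy.1, fun he ↦ hxy.2 he.symm⟩) _ _ (h b a).swap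

lemma isLinearVertex_reverse : (reverse D).IsLinearVertex v ↔ D.IsLinearVertex v :=
  and_comm

/-- `D` is strong on `S` if the subdigraph of `D` induced on `S` is strong. -/
def IsStrongOn (D : Digraph V) (S : Set V) : Prop :=
  ∀ u ∈ S, ∀ v ∈ S, ReflTransGen (fun a b ↦ D.Adj a b ∧ a ∈ S ∧ b ∈ S) u v

lemma IsStrongOn.reverse (hS : IsStrongOn D S) : IsStrongOn (reverse D) S := fun u hu v hv ↦
  ReflTransGen.mono (fun _ _ h ↦ ⟨h.1, h.2.2, h.2.1⟩) _ _ (hS v hv u hu).swap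

/-- The set of vertices reachable from `a` after the arc `ab` has been deleted; these are the
strong sets from which linear vertices are obtained. -/
def reachAvoiding (D : Digraph V) (a b : V) : Set V :=
  {v | ReflTransGen (D.deleteArc a b).Adj a v}

lemma self_mem_reachAvoiding : a ∈ reachAvoiding D a b := ReflTransGen.refl

lemma mem_reachAvoiding_of_adj {u v : V} (hu : u ∈ reachAvoiding D a b) (huv : D.Adj u v)
    (h : ¬(u = a ∧ v = b)) : v ∈ reachAvoiding D a b :=
  ReflTransGen.tail hu ⟨huv, h⟩

lemma notMem_reachAvoiding (hD : D.IsMinimalStrong) (hab : D.Adj a b) :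
    b ∉ reachAvoiding D a b := fun h ↦
  (rel_of_reflTransGen hD (fun _ _ huv ↦ huv.1) hab h).2 ⟨rfl, rfl⟩

lemma reachAvoiding_ne_univ (hD : D.IsMinimalStrong) (hab : D.Adj a b) :
    reachAvoiding D a b ≠ Set.univ :=
  (Set.ne_univ_iff_exists_notMem _).2 ⟨b, notMem_reachAvoiding hD hab⟩

lemma isStrongOn_reachAvoiding (hD : D.IsStrong) (a b : V) :
    IsStrongOn D (reachAvoiding D a b) := by
  intro u hu v hv
  let r x y := D.Adj x y ∧ x ∈ reachAvoiding D a b ∧ y ∈ reachAvoiding D a b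
  -- A walk to `a` can be stopped at its first visit to `a`, so it need not use the arc `ab`.
  have hto : ReflTransGen r u a := by
    induction hD u a using ReflTransGen.head_induction_on with
    | refl => exact .refl
    | @head x y hxy _ ih =>
      by_cases hx : x = a
      · rw [hx]
      · have hy := mem_reachAvoiding_of_adj hu hxy fun h ↦ hx h.1
        exact .head ⟨hxy, hu, hy⟩ (ih hy)
  have hfrom : ReflTransGen r a v := by
    induction hv with
    | refl => exact .refl
    | tail hx hxy ih => exact ih.tail ⟨hxy.1, hx, hx.tail hxy⟩
  exact hto.trans hfrom

lemma IsStrongOn.subset_reachAvoiding (hS : IsStrongOn D S) (hab : ¬(a ∈ S ∧ b ∈ S))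
    (hs : s ∈ S) (hsR : s ∈ reachAvoiding D a b) : S ⊆ reachAvoiding D a b := fun v hv ↦ by
  refine ReflTransGen.trans hsR (ReflTransGen.mono (fun x y hxy ↦ ⟨hxy.1, ?_⟩) _ _ (hS s hs v hv))
  rintro ⟨rfl, rfl⟩
  exact hab hxy.2

lemma mem_reachAvoiding_or_mem_reachAvoiding (hD : D.IsStrong) {a' b' : V} (hne : a = a' → b ≠ b')
    (ha : a ∈ reachAvoiding D a' b') (ha' : a' ∈ reachAvoiding D a b) (v : V) :
    v ∈ reachAvoiding D a b ∨ v ∈ reachAvoiding D a' b' := by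
  induction hD a v with
  | refl => exact .inl self_mem_reachAvoiding
  | @tail x y _ hxy ih =>
    by_cases h : x = a ∧ y = b
    · obtain ⟨rfl, rfl⟩ := h
      exact .inr (mem_reachAvoiding_of_adj ha hxy fun h ↦ hne h.1 h.2)
    by_cases h' : x = a' ∧ y = b'
    · obtain ⟨rfl, rfl⟩ := h'
      exact .inl (mem_reachAvoiding_of_adj ha' hxy h)
    exact ih.imp (mem_reachAvoiding_of_adj · hxy h) (mem_reachAvoiding_of_adj · hxy h')

/-- `T` is maximal, under inclusion, among the proper vertex subsets on which `D` is strong; the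
complement of such a `T` is where linear vertices are found. -/
def IsMaximalStrongOn (D : Digraph V) (T : Set V) : Prop :=
  Maximal (fun S ↦ IsStrongOn D S ∧ S ≠ Set.univ) T

lemma IsMaximalStrongOn.eq_univ (hT : IsMaximalStrongOn D T) (hS : IsStrongOn D S) (hTS : T ⊆ S)
    (hyS : y ∈ S) (hyT : y ∉ T) : S = Set.univ := by
  by_contra hne
  exact hyT (hT.le_of_ge ⟨hS, hne⟩ hTS hyS)

lemma IsMaximalStrongOn.existsUnique_adj_left (hT : IsMaximalStrongOn D T)
    (hD : D.IsMinimalStrong) (hs : s ∈ T) (hy : y ∉ T) (hsy : D.Adj s y) : ∃! w, D.Adj w y := by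
  refine ⟨s, hsy, fun w hwy ↦ ?_⟩
  by_contra hne
  have hD' := isMinimalStrong_reverse hD
  -- `R` consists of the vertices from which `y` can be reached without the arc `wy`.
  let R := reachAvoiding (reverse D) y w
  have hsR : s ∈ R :=
    mem_reachAvoiding_of_adj self_mem_reachAvoiding hsy fun h ↦ hne h.2.symm
  have hTR : T ⊆ R := hT.prop.1.reverse.subset_reachAvoiding (fun h ↦ hy h.1) hs hsR
  exact reachAvoiding_ne_univ hD' hwy <|
    hT.eq_univ (isStrongOn_reachAvoiding hD'.1 y w).reverse hTR self_mem_reachAvoiding hy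

lemma IsMaximalStrongOn.existsUnique_adj_right (hT : IsMaximalStrongOn D T)
    (hD : D.IsMinimalStrong) (hs : s ∈ T) (hy : y ∉ T) : ∃! w, D.Adj y w := by
  have hdisj : ∀ {x}, D.Adj y x → s ∉ reachAvoiding D y x := fun {x} hyx hsR ↦
    reachAvoiding_ne_univ hD hyx <| hT.eq_univ (isStrongOn_reachAvoiding hD.1 y x)
      (hT.prop.1.subset_reachAvoiding (fun h ↦ hy h.1) hs hsR) self_mem_reachAvoiding hy
  obtain rfl | ⟨x, hyx, -⟩ := (hD.1 y s).cases_head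
  · exact absurd hs hy
  refine ⟨x, hyx, fun x' hyx' ↦ ?_⟩
  by_contra hne
  exact (mem_reachAvoiding_or_mem_reachAvoiding hD.1 (fun _ ↦ hne) self_mem_reachAvoiding
    self_mem_reachAvoiding s).elim (hdisj hyx') (hdisj hyx)

/-- The vertices of `S` with an arc of `D` leaving `S`. The vertices of `S` entered from outside `S`
are `exits (reverse D) S`. -/
def exits (D : Digraph V) (S : Set V) : Set V :=
  {s ∈ S | ∃ y ∉ S, D.Adj s y}

lemma exits_nonempty (hD : D.IsStrong) (hS : S.Nonempty) (hne : S ≠ Set.univ) :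
    (exits D S).Nonempty := by
  by_contra hempty
  obtain ⟨s, hs⟩ := hS
  refine hne (Set.eq_univ_of_forall fun v ↦ ?_)
  induction hD s v with
  | refl => exact hs
  | @tail x y _ hxy ih => exact by_contra fun hy ↦ hempty ⟨x, ih, y, hy, hxy⟩

lemma exists_isLinearVertex_notMem [Finite V] (hD : D.IsMinimalStrong) (hS : IsStrongOn D S)
    (hne : S.Nonempty) (hproper : S ≠ Set.univ) : ∃ v ∉ S, D.IsLinearVertex v := by
  obtain ⟨T, hST, hT⟩ : ∃ T, S ⊆ T ∧ IsMaximalStrongOn D T :=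
    (Set.toFinite {T | IsStrongOn D T ∧ T ≠ Set.univ}).exists_le_maximal ⟨hS, hproper⟩
  obtain ⟨s, hs, y, hy, hsy⟩ := exits_nonempty hD.1 (hne.mono hST) hT.prop.2
  exact ⟨y, fun h ↦ hy (hST h), isLinearVertex_iff.2
    ⟨hT.existsUnique_adj_left hD hs hy hsy, hT.existsUnique_adj_right hD hs hy⟩⟩

lemma ncard_exits_le [Finite V] (hD : D.IsMinimalStrong) (hS : IsStrongOn D S) :
    (exits D S).ncard ≤ ({v | D.IsLinearVertex v} \ S).ncard := by
  have hlinear : ∀ s ∈ exits D S, ∃ y v,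
      y ∉ S ∧ v ∉ reachAvoiding D s y ∧ D.IsLinearVertex v := by
    rintro s ⟨-, y, hy, hsy⟩
    obtain ⟨v, hv, hlin⟩ := exists_isLinearVertex_notMem hD (isStrongOn_reachAvoiding hD.1 s y)
      ⟨s, self_mem_reachAvoiding⟩ (reachAvoiding_ne_univ hD hsy)
    exact ⟨y, v, hy, hv, hlin⟩
  choose! y f hy hf hlin using hlinear
  have hsub : ∀ s ∈ exits D S, S ⊆ reachAvoiding D s (y s) := fun s hs ↦
    hS.subset_reachAvoiding (fun h ↦ hy s hs h.2) hs.1 self_mem_reachAvoiding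
  refine Set.ncard_le_ncard_of_injOn f (fun s hs ↦ ⟨hlin s hs, fun h ↦ hf s hs (hsub s hs h)⟩) ?_
  intro s hs s' hs' heq
  by_contra hne
  exact (mem_reachAvoiding_or_mem_reachAvoiding hD.1 (fun h ↦ absurd h hne) (hsub s' hs' hs.1)
    (hsub s hs hs'.1) (f s)).elim (hf s hs) (heq ▸ hf s' hs')

lemma ncard_exits_reverse_le [Finite V] (hD : D.IsMinimalStrong) (hS : IsStrongOn D S) :
    (exits (reverse D) S).ncard ≤ ({v | D.IsLinearVertex v} \ S).ncard := by
  simpa only [isLinearVertex_reverse] using ncard_exits_le (isMinimalStrong_reverse hD) hS.reverse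

lemma reflTransGen_of_forall_add_one {q : ℕ} [NeZero q] {c : ZMod q → V} {r : V → V → Prop}
    (hr : ∀ i, r (c i) (c (i + 1))) (i j : ZMod q) : ReflTransGen r (c i) (c j) := by
  have hadd : ∀ n : ℕ, ReflTransGen r (c i) (c (i + n)) := fun n ↦ by
    induction n with
    | zero => rw [Nat.cast_zero, add_zero]
    | succ n ih => simpa only [Nat.cast_succ, add_assoc] using ih.tail (hr (i + n))
  simpa only [ZMod.natCast_zmod_val, add_sub_cancel] using hadd (j - i).val

section Cycle

variable {q : ℕ} {c : ZMod q → V}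

lemma isStrongOn_range (hc : D.IsDirectedCycle q c) : IsStrongOn D (Set.range c) := by
  have : NeZero q := ⟨hc.1.ne'⟩
  rintro _ ⟨i, rfl⟩ _ ⟨j, rfl⟩
  exact reflTransGen_of_forall_add_one (fun k ↦ ⟨hc.2.2 k, ⟨k, rfl⟩, ⟨k + 1, rfl⟩⟩) i j

lemma eq_add_one_of_adj (hD : D.IsMinimalStrong) (hc : D.IsDirectedCycle q c) {i j : ZMod q}
    (hij : D.Adj (c i) (c j)) : j = i + 1 := by
  have : NeZero q := ⟨hc.1.ne'⟩
  obtain ⟨k, hki, hkj⟩ : ∃ k, c i = c k ∧ c j = c (k + 1) :=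
    rel_of_reflTransGen hD (r := fun u v ↦ ∃ k, u = c k ∧ v = c (k + 1))
      (by rintro _ _ ⟨k, rfl, rfl⟩; exact hc.2.2 k) hij
      (reflTransGen_of_forall_add_one (fun k ↦ ⟨k, rfl, rfl⟩) i j)
  rw [hc.2.1 hki, hc.2.1 hkj]

lemma isLinearVertex_of_notMem_exits (hD : D.IsMinimalStrong) (hc : D.IsDirectedCycle q c)
    {i : ZMod q} (hout : c i ∉ exits D (Set.range c))
    (hin : c i ∉ exits (reverse D) (Set.range c)) : D.IsLinearVertex (c i) := by
  have hpred : D.Adj (c (i - 1)) (c i) := by simpa only [sub_add_cancel] using hc.2.2 (i - 1)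
  refine isLinearVertex_iff.2 ⟨⟨_, hpred, fun w hw ↦ ?_⟩, ⟨_, hc.2.2 i, fun w hw ↦ ?_⟩⟩
  · obtain ⟨j, rfl⟩ := by_contra fun h ↦ hin ⟨⟨i, rfl⟩, w, h, hw⟩
    rw [eq_add_one_of_adj hD hc hw, add_sub_cancel_right]
  · obtain ⟨j, rfl⟩ := by_contra fun h ↦ hout ⟨⟨i, rfl⟩, w, h, hw⟩
    rw [eq_add_one_of_adj hD hc hw]

lemma range_subset_linear_union_exits (hD : D.IsMinimalStrong) (hc : D.IsDirectedCycle q c) :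
    Set.range c ⊆ {v | D.IsLinearVertex v} ∩ Set.range c ∪
      (exits D (Set.range c) ∪ exits (reverse D) (Set.range c)) := by
  rintro _ ⟨i, rfl⟩
  by_contra h
  obtain ⟨hlin, hexits⟩ := not_or.1 h
  obtain ⟨hout, hin⟩ := not_or.1 hexits
  exact hlin ⟨isLinearVertex_of_notMem_exits hD hc hout hin, i, rfl⟩

lemma length_le_ncard_inter_add_two_mul_ncard_sdiff [Finite V] (hD : D.IsMinimalStrong)
    (hc : D.IsDirectedCycle q c) :
    q ≤ ({v | D.IsLinearVertex v} ∩ Set.range c).ncard +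
      2 * ({v | D.IsLinearVertex v} \ Set.range c).ncard := by
  have hS := isStrongOn_range hc
  calc q = (Set.range c).ncard := by rw [Set.ncard_range_of_injective hc.2.1, Nat.card_zmod]
    _ ≤ ({v | D.IsLinearVertex v} ∩ Set.range c ∪
          (exits D (Set.range c) ∪ exits (reverse D) (Set.range c))).ncard :=
        Set.ncard_le_ncard (range_subset_linear_union_exits hD hc)
    _ ≤ ({v | D.IsLinearVertex v} ∩ Set.range c).ncard +
          ((exits D (Set.range c)).ncard + (exits (reverse D) (Set.range c)).ncard) :=
        (Set.ncard_union_le _ _).trans (Nat.add_le_add_left (Set.ncard_union_le _ _) _)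
    _ ≤ _ := by
        rw [two_mul]
        exact Nat.add_le_add_left
          (Nat.add_le_add (ncard_exits_le hD hS) (ncard_exits_reverse_le hD hS)) _

end Cycle

end MinimalStrongDigraph

theorem theorem4 {V : Type*} [Finite V] (D : Digraph V) (hD : D.IsMinimalStrong)
    (q : ℕ) (c : ZMod q → V) (hc : D.IsDirectedCycle q c) :
    (q + 1) / 2 ≤ {v : V | D.IsLinearVertex v}.ncard := by
  have hlength := MinimalStrongDigraph.length_le_ncard_inter_add_two_mul_ncard_sdiff hD hc
  have hsplit := Set.ncard_inter_add_ncard_sdiff_eq_ncard {v | D.IsLinearVertex v} (Set.range c)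
  omega
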